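/- Let $d\ge 2$, and let $\omega_1,\dots,\omega_d$ be the fundamental weights and $\alpha_1,\dots,\alpha_d$ the simple roots of $SL_{d+1}$. Let $n,k,s_1,\dots,s_d$ be non-negative integers with $s_1=n+k$ such that the weight $$\nu=(2n-1)\omega_1-s_1\alpha_1-\cdots-s_d\alpha_d$$ is dominant. Put $h_i=s_i-s_{i+1}$ for $1\le i\le d-1$, $h_d=s_d$, and $h=(h_1,\dots,h_d)$; then $h_1+\cdots+h_d=n+k$. For $\ell\in\mathbb{Z}$ let $$C(d,h,\ell)=\{(b_1,\dots,b_d)\in\mathbb{Z}^d : b_1+\cdots+b_d=\ell,\ 0\le b_i\le h_i \text{ for all } i\},$$ and set $\delta_\ell=|C(d,h,\ell)|-|C(d,h,\ell-1)|$ and $S_\ell=\sum_{0\le j\le \ell}|C(d,h,j)|$. Multinomial coefficients with a negative lower entry are $0$. Order $C(d,h,k)$ in any way, and order $C(d,h,n)$ correspondingly through the bijection $b\mapsto h-b$ from $C(d,h,k)$ to $C(d,h,n)$. Let $k'$ be the largest odd integer $\le k$. (1) If $h_1\ge k$, then for all $\ell\in\{0,\dots,k\}$, $$\delta_{k-\ell}=|\{b\in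 C(d,h,k) : b_1=\ell\}|,$$ and $$\det\left(\binom{n-k}{b_1-b_1',\dots,b_d-b_d'}\right)_{b\in C(d,h,n),\ b'\in C(d,h,k)}=(-1)^{S_{k'}}\,\frac{\prod_{b\in C(d,h,n)}\binom{n}{b_1,b_2,\dots,b_d}}{\prod_{b'\in C(d,h,k)}\binom{n}{b_1'+n-k,\,b_2',\dots,b_d'}}.$$ (2) If $d=2$ or $d=3$, then $h_1\ge k$ always holds. -/

import Mathlib

/-! Weights of `SL_{d+1}` are written in the basis `ω₁, …, ω_d` of fundamental weights, so the weight
lattice is `Fin d → ℤ`. All indices are shifted by one: the index `i : Fin d` stands for `i + 1`. -/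

namespace MultinomialDet

/-- The fundamental weight `ω_{i+1}`. -/
def fundWeight {d : ℕ} (i : Fin d) : Fin d → ℤ := Pi.single i 1

/-- The simple root `α_{i+1}` of type `A_d`, in the basis of fundamental weights. -/
def simpleRoot {d : ℕ} (i : Fin d) : Fin d → ℤ := fun j => CartanMatrix.A d i j

/-- A weight is dominant if its coordinates on the fundamental weights are non-negative. -/
def IsDominant {d : ℕ} (v : Fin d → ℤ) : Prop := ∀ i, 0 ≤ v i

/-- The weight `ν = (2n - 1) ω₁ - s₁ α₁ - ⋯ - s_d α_d`. -/
def nu {d : ℕ} [NeZero d] (n : ℕ) (s : Fin d → ℕ) : Fin d → ℤ :=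
  (2 * (n : ℤ) - 1) • fundWeight 0 - ∑ i, (s i : ℤ) • simpleRoot i

/-- `h_i = s_i - s_{i+1}` for `i < d`, and `h_d = s_d`. -/
def gaps {d : ℕ} (s : Fin d → ℕ) (i : Fin d) : ℤ :=
  (s i : ℤ) - if hi : (i : ℕ) + 1 < d then (s ⟨(i : ℕ) + 1, hi⟩ : ℤ) else 0

/-- The set `C(d, h, ℓ)` of tuples of integers `b` with `0 ≤ b_i ≤ h_i` and `∑ b_i = ℓ`.
It is empty for negative `ℓ`. -/
noncomputable def C {d : ℕ} (h : Fin d → ℤ) (l : ℤ) : Finset (Fin d → ℤ) :=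
  (Finset.Icc 0 h).filter fun b => ∑ i, b i = l

/-- `δ_ℓ = |C(d, h, ℓ)| - |C(d, h, ℓ - 1)|`. -/
noncomputable def delta {d : ℕ} (h : Fin d → ℤ) (l : ℤ) : ℤ := ((C h l).card : ℤ) - (C h (l - 1)).card

/-- `S_ℓ = |C(d, h, 0)| + ⋯ + |C(d, h, ℓ)|`, an empty sum for negative `ℓ`. -/
noncomputable def S {d : ℕ} (h : Fin d → ℤ) (l : ℤ) : ℕ := ∑ j ∈ Finset.Icc 0 l, (C h j).card

/-- The multinomial coefficient `N! / (c₁! ⋯ c_d!)`, which is zero unless all `c_i` are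
non-negative and add up to `N`. -/
def multinom {d : ℕ} (N : ℤ) (c : Fin d → ℤ) : ℤ :=
  if (∀ i, 0 ≤ c i) ∧ ∑ i, c i = N then
    (Nat.multinomial Finset.univ fun i => (c i).toNat : ℕ) else 0

/-- The matrix of multinomial coefficients, with rows indexed by `b ∈ C(d, h, n)` and columns
indexed by `b' ∈ C(d, h, k)`. -/
noncomputable def multinomMatrix {d : ℕ} (h : Fin d → ℤ) (n k : ℕ) :
    Matrix (C h n) (C h k) ℤ :=
  Matrix.of fun b b' => multinom ((n : ℤ) - k) (b.1 - b'.1)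

theorem sub_mem_C {d : ℕ} {h : Fin d → ℤ} {l l' : ℤ} (hl : ∑ i, h i = l + l')
    {b : Fin d → ℤ} (hb : b ∈ C h l) : h - b ∈ C h l' := by
  simp only [C, Finset.mem_filter, Finset.mem_Icc] at hb ⊢
  obtain ⟨⟨h0, h1⟩, h2⟩ := hb
  refine ⟨⟨sub_nonneg.2 h1, sub_le_self _ h0⟩, ?_⟩
  simp only [Pi.sub_apply, Finset.sum_sub_distrib]
  omega

/-- The bijection `b ↦ h - b` from `C(d, h, ℓ)` to `C(d, h, ℓ')`, where `∑ h_i = ℓ + ℓ'`. -/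
noncomputable def complEquiv {d : ℕ} (h : Fin d → ℤ) (l l' : ℤ) (hl : ∑ i, h i = l + l') :
    C h l ≃ C h l' where
  toFun b := ⟨h - b.1, sub_mem_C hl b.2⟩
  invFun b := ⟨h - b.1, sub_mem_C (hl.trans (add_comm l l')) b.2⟩
  left_inv b := Subtype.ext (sub_sub_cancel h b.1)
  right_inv b := Subtype.ext (sub_sub_cancel h b.1)

theorem sum_gaps {d : ℕ} [NeZero d] (s : Fin d → ℕ) {n k : ℕ} (hs : s 0 = n + k) :
    ∑ i, gaps s i = (k : ℤ) + n := by
  let f : ℕ → ℤ := fun i => if hi : i < d then (s ⟨i, hi⟩ : ℤ) else 0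
  have h1 : ∀ i : Fin d, gaps s i = f i - f ((i : ℕ) + 1) := by
    intro i
    simp [gaps, f]
  have h2 : f 0 = s 0 := by
    have : 0 < d := Nat.pos_of_ne_zero (NeZero.ne d)
    simp only [f, this, dif_pos]
    rfl
  have h3 : f d = 0 := by simp [f]
  rw [Finset.sum_congr rfl fun i _ => h1 i,
    Fin.sum_univ_eq_sum_range (fun i => f i - f (i + 1)) d, Finset.sum_range_sub', h2, h3, hs]
  push_cast
  ring

end MultinomialDet

/-!
Let `A = ℚ[x₁, …, x_d] / (x₁ ^ (h₁ + 1), …, x_d ^ (h_d + 1))` and `L = x₁ + ⋯ + x_d`. The matrix of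
multinomial coefficients is that of multiplication by `L ^ (n - k)` from degree `k` to degree `n`
of `A`, in the bases of monomials. As `k ≤ h₁`, the degree `k` part of `A` puts no bound on the
exponent of `x₁`, and the elements `L ^ b₁ x₂ ^ b₂ ⋯ x_d ^ b_d` form another basis of it,
unitriangular over the monomials (`det_basisChange`). Their images
`L ^ (n - k + b₁) x₂ ^ b₂ ⋯ x_d ^ b_d` have again multinomial coefficients
(`multinomMatrix_mul_basisChange`, an instance of the Chu–Vandermonde identity
`sum_multinom_mul_multinom`). The new entry in row `h - c` and column `b` is, up to a factor
depending on `c` only and a factor depending on `b` only, the product of the binomial coefficients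
`choose (h_i - c_i) b_i` over `i ≥ 2` (`multinom_eq_mul_prod_choose`). The two kinds of factors
give the quotient of products of multinomial coefficients.

There remains the determinant of the products of binomial coefficients. Here `c` and `b` run over
the `(d - 1)`-tuples bounded by `(h₂, …, h_d)` with sum at most `k`. They form a lower set, so by
the inclusion-exclusion identity
`choose (h - c) b = ∑ j, (-1) ^ j * choose c j * choose (h - j) (b - j)` the matrix is a product of
two unitriangular matrices and a diagonal matrix of signs between them (`det_prod_choose_sub`). The
determinant is therefore `∏ (-1) ^ (k - b₁)`, over `b` in `C(d, h, k)`.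

For `k ≤ h₁`, adding `ℓ` to the first coordinate identifies `C(d, h, k - ℓ)` with the set of all
`b` in `C(d, h, k)` with `b₁ ≥ ℓ` (`card_C_sub`). This gives the formula for `δ_{k - ℓ}` at once,
and it shows that `S_{k'}` has the same parity as the sum of all `k - b₁` (`neg_one_pow_S`).
-/

namespace MultinomialDet

open Finset

/-! ### Triangular determinants -/

/-- In the Leibniz expansion, a permutation `σ` with only nonzero factors satisfies
`f (σ i) ≤ f i` everywhere, strictly unless `σ i = i`; summing over `i` forces `σ = 1`. -/
theorem det_eq_prod_diag_of_rank {m R α : Type*} [Fintype m] [DecidableEq m] [CommRing R]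
    [AddCommMonoid α] [PartialOrder α] [IsOrderedCancelAddMonoid α] (f : m → α)
    (M : Matrix m m R) (hM : ∀ i j, M i j ≠ 0 → i ≠ j → f i < f j) :
    M.det = ∏ i, M i i := by
  rw [Matrix.det_apply]
  refine (Finset.sum_eq_single 1 ?_ (by simp)).trans (by simp)
  intro σ _ hσ
  have : ∃ i, M (σ i) i = 0 := by
    by_contra! hne
    obtain ⟨i₀, hi₀⟩ : ∃ i, σ i ≠ i := by
      by_contra! h
      exact hσ (Equiv.ext h)
    have hlt : ∑ i, f (σ i) < ∑ i, f i := by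
      refine Finset.sum_lt_sum (fun i _ => ?_) ⟨i₀, mem_univ _, hM _ _ (hne i₀) hi₀⟩
      by_cases h : σ i = i
      · rw [h]
      · exact (hM _ _ (hne i) h).le
    exact absurd (Equiv.sum_comp σ f) hlt.ne
  obtain ⟨i, hi⟩ := this
  rw [Finset.prod_eq_zero (f := fun i => M (σ i) i) (mem_univ i) hi, smul_zero]

/-! ### Products of binomial coefficients on a lower set -/

theorem sum_range_neg_one_pow_mul_choose_succ (c : ℕ) (f : ℕ → ℤ) :
    ∑ j ∈ range (c + 2), (-1) ^ j * ((c + 1).choose j : ℤ) * f j =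
      ∑ j ∈ range (c + 1), (-1) ^ j * (c.choose j : ℤ) * (f j - f (j + 1)) := by
  have h1 : ∑ j ∈ range (c + 1), (-1 : ℤ) ^ j * (c.choose j : ℤ) * f j =
      ∑ j ∈ range (c + 1), (-1 : ℤ) ^ (j + 1) * (c.choose (j + 1) : ℤ) * f (j + 1) + f 0 := by
    have := Finset.sum_range_succ' (fun j => (-1 : ℤ) ^ j * (c.choose j : ℤ) * f j) (c + 1)
    rw [Finset.sum_range_succ] at this
    simpa using this
  rw [Finset.sum_range_succ']
  simp only [mul_sub, Finset.sum_sub_distrib]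
  rw [h1]
  simp only [pow_zero, Nat.choose_zero_right, Nat.cast_one, one_mul, Nat.choose_succ_succ,
    Nat.cast_add, mul_add, add_mul, Finset.sum_add_distrib, pow_succ, mul_neg, mul_one, neg_mul,
    Finset.sum_neg_distrib]
  ring

/-- Writing `choose (h - j) (h - b)` for `choose (h - j) (b - j)` makes the terms with `b < j`
vanish. -/
theorem choose_sub_eq_sum (c : ℕ) : ∀ h b : ℕ, c ≤ h → b ≤ h →
    ((h - c).choose b : ℤ) =
      ∑ j ∈ range (c + 1), (-1) ^ j * (c.choose j : ℤ) * ((h - j).choose (h - b) : ℤ) := by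
  induction c with
  | zero => intro h b _ hb; simp [Nat.choose_symm hb]
  | succ c ih =>
    intro h b hc hb
    obtain ⟨h, rfl⟩ : ∃ h', h = h' + 1 := ⟨h - 1, by omega⟩
    rw [sum_range_neg_one_pow_mul_choose_succ c fun j => ((h + 1 - j).choose (h + 1 - b) : ℤ)]
    simp only [mul_sub, Finset.sum_sub_distrib]
    rw [← ih (h + 1) b (by omega) hb]
    have e : h + 1 - c = (h - c) + 1 := by omega
    rcases b with _ | b
    · rw [Finset.sum_eq_zero]
      · simp
      · intro j _
        rw [Nat.choose_eq_zero_of_lt (by omega : h + 1 - (j + 1) < h + 1 - 0)]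
        simp
    · have := ih h b (by omega) (by omega)
      simp only [Nat.add_sub_add_right]
      rw [← this, e, Nat.choose_succ_succ]
      push_cast
      ring

theorem prod_choose_ne_zero {ι : Type*} [Fintype ι] {a b : ι → ℕ}
    (h : (∏ i, ((a i).choose (b i) : ℤ)) ≠ 0) : b ≤ a := by
  intro i
  by_contra! hi
  exact h (Finset.prod_eq_zero (mem_univ i) (by rw [Nat.choose_eq_zero_of_lt hi, Nat.cast_zero]))

/-- Inclusion-exclusion factors the matrix as (lower unitriangular) × (diagonal of signs) ×
(upper unitriangular); the middle index stays in `D` because `D` is a lower set. -/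
theorem det_prod_choose_sub {ι : Type*} [Fintype ι] [DecidableEq ι] (D : Finset (ι → ℕ))
    (hD : IsLowerSet (D : Set (ι → ℕ))) (h : ι → ℕ) (hh : ∀ c ∈ D, c ≤ h) :
    (Matrix.of fun c b : D => ∏ i, ((h i - c.1 i).choose (b.1 i) : ℤ)).det =
      ∏ c : D, (-1) ^ ∑ i, c.1 i := by
  set T : Matrix D D ℤ := Matrix.of fun c j => ∏ i, ((c.1 i).choose (j.1 i) : ℤ) with hT
  set V : Matrix D D ℤ := Matrix.of fun j b => ∏ i, ((h i - j.1 i).choose (h i - b.1 i) : ℤ)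
    with hV
  have key : (Matrix.of fun c b : D => ∏ i, ((h i - c.1 i).choose (b.1 i) : ℤ)) =
      T * Matrix.diagonal (fun j : D => (-1 : ℤ) ^ ∑ i, j.1 i) * V := by
    ext c b
    rw [Matrix.mul_apply]
    simp only [Matrix.mul_diagonal, hT, hV, Matrix.of_apply]
    have h1 : ∀ i, ((h i - c.1 i).choose (b.1 i) : ℤ) = ∑ j ∈ range (c.1 i + 1),
        (-1) ^ j * ((c.1 i).choose j : ℤ) * ((h i - j).choose (h i - b.1 i) : ℤ) := fun i =>
      choose_sub_eq_sum _ _ _ (hh c.1 c.2 i) (hh b.1 b.2 i)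
    rw [Finset.prod_congr rfl fun i _ => h1 i, Finset.prod_univ_sum]
    rw [Finset.sum_coe_sort D fun j => (∏ i, ((c.1 i).choose (j i) : ℤ)) * (-1) ^ (∑ i, j i) *
      ∏ i, ((h i - j i).choose (h i - b.1 i) : ℤ)]
    have h2 : Fintype.piFinset (fun i => range (c.1 i + 1)) ⊆ D := by
      intro j hj
      rw [Fintype.mem_piFinset] at hj
      exact hD (fun i => Nat.lt_succ_iff.1 (mem_range.1 (hj i))) c.2
    rw [← Finset.sum_subset h2]
    · refine Finset.sum_congr rfl fun j _ => ?_
      rw [Finset.prod_mul_distrib, Finset.prod_mul_distrib, Finset.prod_pow_eq_pow_sum]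
      ring
    · intro j _ hj
      by_contra hne
      refine hj (Fintype.mem_piFinset.2 fun i => mem_range.2 (Nat.lt_succ_iff.2 ?_))
      exact prod_choose_ne_zero (left_ne_zero_of_mul (left_ne_zero_of_mul hne)) i
  have sum_lt : ∀ a b : D, a.1 ≤ b.1 → a ≠ b → ∑ i, a.1 i < ∑ i, b.1 i := by
    intro a b hab hne
    have hlt : a.1 < b.1 := lt_of_le_of_ne hab fun e => hne (Subtype.ext e)
    obtain ⟨hle, i, hi⟩ := Pi.lt_def.1 hlt
    exact Finset.sum_lt_sum (fun i _ => hle i) ⟨i, mem_univ i, hi⟩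
  have dT : T.det = 1 := by
    rw [← Matrix.det_transpose, det_eq_prod_diag_of_rank fun c : D => ∑ i, c.1 i]
    · simp [hT]
    · exact fun j c hne hjc => sum_lt j c (prod_choose_ne_zero hne) hjc
  have dV : V.det = 1 := by
    rw [det_eq_prod_diag_of_rank fun c : D => ∑ i, c.1 i]
    · simp [hV]
    · refine fun j b hne hjb => sum_lt j b (fun i => ?_) hjb
      have h1 : h i - b.1 i ≤ h i - j.1 i := prod_choose_ne_zero hne i
      have h2 : b.1 i ≤ h i := hh b.1 b.2 i
      have h3 : j.1 i ≤ h i := hh j.1 j.2 i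
      change j.1 i ≤ b.1 i
      omega
  rw [key, Matrix.det_mul, Matrix.det_mul, dT, dV, Matrix.det_diagonal, one_mul, mul_one]

/-! ### Multinomial coefficients -/

theorem coeff_sum_X_pow {σ : Type*} [Fintype σ] [DecidableEq σ] (p : ℕ) (m : σ →₀ ℕ) :
    MvPolynomial.coeff m ((∑ i, MvPolynomial.X i : MvPolynomial σ ℤ) ^ p) =
      if ∑ i, m i = p then (Nat.multinomial univ m : ℤ) else 0 := by
  rw [Finset.sum_pow_eq_sum_piAntidiag, MvPolynomial.coeff_sum]
  have h1 : ∀ x : σ → ℕ, MvPolynomial.coeff m ((Nat.multinomial univ x : MvPolynomial σ ℤ) *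
      ∏ i, MvPolynomial.X i ^ x i) = if x = m then (Nat.multinomial univ x : ℤ) else 0 := by
    intro x
    have h2 : (∏ i, MvPolynomial.X i ^ x i : MvPolynomial σ ℤ) =
        MvPolynomial.monomial (Finsupp.equivFunOnFinite.symm x) 1 := by
      rw [MvPolynomial.monomial_eq, Finsupp.prod_fintype _ _ (by simp)]
      simp
    rw [h2, ← map_natCast (MvPolynomial.C : ℤ →+* MvPolynomial σ ℤ), MvPolynomial.coeff_C_mul,
      MvPolynomial.coeff_monomial]
    have h3 : Finsupp.equivFunOnFinite.symm x = m ↔ x = m := by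
      rw [Equiv.symm_apply_eq]; rfl
    simp [h3]
  simp only [h1, Finset.sum_ite_eq', mem_piAntidiag]
  simp

theorem multinom_natCast {d : ℕ} (p : ℕ) (x : Fin d → ℕ) :
    multinom p (fun i => (x i : ℤ)) = if ∑ i, x i = p then (Nat.multinomial univ x : ℤ) else 0 := by
  have h : (∑ i, (x i : ℤ) = p) ↔ ∑ i, x i = p := by exact_mod_cast Iff.rfl
  simp [multinom, h]

theorem nonneg_of_multinom_ne_zero {d : ℕ} {N : ℤ} {c : Fin d → ℤ} (h : multinom N c ≠ 0) :
    0 ≤ c := by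
  by_contra hc
  exact h (if_neg fun h' => hc h'.1)

theorem sum_eq_of_multinom_ne_zero {d : ℕ} {N : ℤ} {c : Fin d → ℤ} (h : multinom N c ≠ 0) :
    ∑ i, c i = N := by
  by_contra hc
  exact h (if_neg fun h' => hc h'.2)

theorem mem_C {d : ℕ} {h : Fin d → ℤ} {l : ℤ} {b : Fin d → ℤ} :
    b ∈ C h l ↔ 0 ≤ b ∧ b ≤ h ∧ ∑ i, b i = l := by
  simp [C, and_assoc]

/-- The Chu–Vandermonde identity for multinomial coefficients: compare the coefficients of `x ^ y`
in `(∑ x_i) ^ q * (∑ x_i) ^ p = (∑ x_i) ^ (q + p)`. -/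
theorem sum_multinom_mul_multinom {d : ℕ} (q p : ℕ) (y : Fin d → ℤ) :
    ∑ x ∈ C y q, multinom q x * multinom p (y - x) = multinom ((q + p : ℕ) : ℤ) y := by
  by_cases hy : 0 ≤ y
  · lift y to Fin d → ℕ using hy
    have h1 := coeff_sum_X_pow (q + p) (Finsupp.equivFunOnFinite.symm y)
    rw [pow_add, MvPolynomial.coeff_mul] at h1
    simp only [coeff_sum_X_pow] at h1
    rw [multinom_natCast]
    refine Eq.trans ?_ h1
    symm
    refine Finset.sum_bij_ne_zero (fun x _ _ i => (x.1 i : ℤ)) ?_ ?_ ?_ ?_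
    · intro x hx hne
      rw [HasAntidiagonal.mem_antidiagonal] at hx
      have hq : ∑ i, x.1 i = q := by
        by_contra hq
        exact hne (by rw [if_neg hq, zero_mul])
      refine mem_C.2 ⟨fun i => by simp, fun i => ?_, by exact_mod_cast hq⟩
      have := DFunLike.congr_fun hx i
      simp only [Finsupp.add_apply, Finsupp.equivFunOnFinite_symm_apply_apply] at this
      simp only [Nat.cast_le]
      omega
    · intro a ha _ b hb _ hab
      have h2 : a.1 = b.1 := Finsupp.ext fun i => by exact_mod_cast congrFun hab i
      rw [HasAntidiagonal.mem_antidiagonal] at ha hb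
      refine Prod.ext h2 ?_
      rw [← hb, h2] at ha
      exact add_left_cancel ha
    · intro b hb _
      obtain ⟨h0, h2, h3⟩ := mem_C.1 hb
      lift b to Fin d → ℕ using h0
      refine ⟨(Finsupp.equivFunOnFinite.symm b, Finsupp.equivFunOnFinite.symm (y - b)), ?_, ?_, ?_⟩
      · rw [HasAntidiagonal.mem_antidiagonal]
        ext i
        have := h2 i
        simp only [Nat.cast_le] at this
        simp [this]
      · rename_i hne
        convert hne using 1
        rw [multinom_natCast]
        rw [show ((fun i => (y i : ℤ)) - fun i => (b i : ℤ)) = fun i => (((y - b) i : ℕ) : ℤ) from ?_,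
          multinom_natCast]
        · rfl
        · ext i
          have := h2 i
          simp only [Nat.cast_le] at this
          simp [this]
      · rfl
    · intro x hx hne
      rw [HasAntidiagonal.mem_antidiagonal] at hx
      rw [multinom_natCast]
      rw [show ((fun i => (y i : ℤ)) - fun i => (x.1 i : ℤ)) = fun i => ((x.2 i : ℕ) : ℤ) from ?_,
          multinom_natCast]
      ext i
      have := DFunLike.congr_fun hx i
      simp only [Finsupp.add_apply, Finsupp.equivFunOnFinite_symm_apply_apply] at this
      simp [← this]
  · have h1 : multinom ((q + p : ℕ) : ℤ) y = 0 := by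
      by_contra h
      exact hy (nonneg_of_multinom_ne_zero h)
    rw [h1]
    refine Finset.sum_eq_zero fun x hx => ?_
    obtain ⟨h0, h2, -⟩ := mem_C.1 hx
    exact absurd (h0.trans h2) hy

theorem multinom_eq_div {d : ℕ} {N : ℤ} {c : Fin d → ℤ} (h0 : 0 ≤ c) (hN : ∑ i, c i = N) :
    (multinom N c : ℚ) = (N.toNat.factorial : ℚ) / ∏ i, ((c i).toNat.factorial : ℚ) := by
  have h1 : ∑ i, (c i).toNat = N.toNat := by
    have : ((∑ i, (c i).toNat : ℕ) : ℤ) = N := by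
      rw [← hN, Nat.cast_sum]
      exact Finset.sum_congr rfl fun i _ => Int.toNat_of_nonneg (h0 i)
    omega
  have h2 := Nat.multinomial_spec univ fun i => (c i).toNat
  rw [h1] at h2
  rw [multinom, if_pos ⟨h0, hN⟩, eq_div_iff]
  · rw [← h2]
    push_cast
    ring
  · exact Finset.prod_ne_zero_iff.2 fun i _ => by exact_mod_cast Nat.factorial_ne_zero _

/-! ### Counting bounded tuples by their first coordinate -/

section Counting

variable {d : ℕ} [NeZero d]

theorem zero_coord_le {h : Fin d → ℤ} {k : ℤ} {b : Fin d → ℤ} (hb : b ∈ C h k) : b 0 ≤ k := by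
  obtain ⟨h0, -, h2⟩ := mem_C.1 hb
  rw [← h2]
  exact Finset.single_le_sum (fun i _ => h0 i) (mem_univ 0)

/-- Shifting the first coordinate by `l` is a bijection from `C(d, h, k - l)`. -/
theorem card_C_sub {h : Fin d → ℤ} {k : ℤ} (hk : k ≤ h 0) {l : ℤ} (hl : 0 ≤ l) :
    (C h (k - l)).card = ((C h k).filter fun b => l ≤ b 0).card := by
  have hsum : ∀ b : Fin d → ℤ, ∑ i, (b + Pi.single 0 l : Fin d → ℤ) i = ∑ i, b i + l := by
    intro b
    simp [Finset.sum_add_distrib, Finset.sum_pi_single']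
  refine Finset.card_bij (fun b _ => b + Pi.single 0 l) ?_ ?_ ?_
  · intro b hb
    have h3 := zero_coord_le hb
    obtain ⟨h0, h1, h2⟩ := mem_C.1 hb
    refine mem_filter.2 ⟨mem_C.2 ⟨?_, fun i => ?_, ?_⟩, ?_⟩
    · exact add_nonneg h0 (Pi.single_nonneg.2 hl)
    · rcases eq_or_ne i 0 with rfl | hi
      · simp only [Pi.add_apply, Pi.single_eq_same]
        omega
      · simpa [Pi.single_eq_of_ne hi] using h1 i
    · rw [hsum, h2]; ring
    · simpa using h0 0
  · intro a _ b _ hab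
    exact add_right_cancel hab
  · intro b hb
    obtain ⟨hb, hlb⟩ := mem_filter.1 hb
    obtain ⟨h0, h1, h2⟩ := mem_C.1 hb
    refine ⟨b - Pi.single 0 l, mem_C.2 ⟨fun i => ?_, ?_, ?_⟩, sub_add_cancel _ _⟩
    · rcases eq_or_ne i 0 with rfl | hi
      · simpa using hlb
      · simpa [Pi.single_eq_of_ne hi] using h0 i
    · exact (sub_le_self _ (Pi.single_nonneg.2 hl)).trans h1
    · have := hsum (b - Pi.single 0 l)
      rw [sub_add_cancel] at this
      linarith

theorem delta_sub {h : Fin d → ℤ} {k : ℤ} (hk : k ≤ h 0) {l : ℤ} (hl : 0 ≤ l) :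
    delta h (k - l) = (((C h k).filter fun b => b 0 = l).card : ℤ) := by
  rw [delta, sub_sub, card_C_sub hk hl, card_C_sub hk (by omega : 0 ≤ l + 1), sub_eq_iff_eq_add,
    ← Nat.cast_add, ← Finset.card_union_of_disjoint]
  · congr 2
    ext b
    simp only [mem_union, mem_filter, ← and_or_left]
    refine and_congr_right fun _ => ?_
    omega
  · refine Finset.disjoint_filter.2 fun b _ h1 h2 => ?_
    omega

theorem S_eq_sum {h : Fin d → ℤ} {k k' : ℤ} (hk : k ≤ h 0) (hk' : k' ≤ k) :
    S h k' = ∑ b ∈ C h k, (k' + 1 - (k - b 0)).toNat := by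
  have h1 : ∀ j ∈ Finset.Icc 0 k', (C h j).card = ∑ b ∈ C h k, if k - b 0 ≤ j then 1 else 0 := by
    intro j hj
    rw [Finset.mem_Icc] at hj
    have := card_C_sub hk (by omega : 0 ≤ k - j)
    rw [sub_sub_cancel] at this
    rw [this, Finset.card_filter]
    refine Finset.sum_congr rfl fun b _ => ?_
    congr 1
    exact propext ⟨fun _ => by omega, fun _ => by omega⟩
  rw [S, Finset.sum_congr rfl h1, Finset.sum_comm]
  refine Finset.sum_congr rfl fun b hb => ?_
  have := zero_coord_le hb
  rw [← Finset.card_filter, ← Int.card_Icc]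
  congr 1
  ext j
  simp only [mem_filter, Finset.mem_Icc]
  omega

/-- The sign `(-1) ^ S_{k'}` is a product of local signs: as `k' + 1` is even, `b` contributes to
`S_{k'}` a number of the same parity as `k - b₁`. -/
theorem neg_one_pow_S {h : Fin d → ℤ} {k k' : ℤ} (hk : k ≤ h 0)
    (hk' : IsGreatest {j : ℤ | Odd j ∧ j ≤ k} k') :
    (-1 : ℤ) ^ S h k' = ∏ b ∈ C h k, (-1) ^ (k - b 0).toNat := by
  obtain ⟨⟨⟨r, hr⟩, hle⟩, hmax⟩ := hk'
  have hge : k - 1 ≤ k' := by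
    by_contra! hlt
    have : k' + 2 ≤ k' := hmax ⟨⟨r + 1, by rw [hr]; ring⟩, by omega⟩
    omega
  rw [S_eq_sum hk hle, ← Finset.prod_pow_eq_pow_sum]
  refine Finset.prod_congr rfl fun b hb => ?_
  have h1 := zero_coord_le hb
  have h2 := (mem_C.1 hb).1 0
  simp only [Pi.zero_apply] at h2
  rw [neg_one_pow_eq_pow_mod_two, neg_one_pow_eq_pow_mod_two (n := (k - b 0).toNat)]
  congr 1
  omega

end Counting

/-! ### Factorizations of the multinomial matrix -/

section Tail

variable {d : ℕ} [NeZero d]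

/-- The coordinates of `b` other than the first one, as natural numbers. -/
def tail (b : Fin d → ℤ) : {i : Fin d // i ≠ 0} → ℕ := fun i => (b i.1).toNat

theorem sum_tail {h : Fin d → ℤ} {k : ℤ} {b : Fin d → ℤ} (hb : b ∈ C h k) :
    ((∑ i, tail b i : ℕ) : ℤ) = k - b 0 := by
  obtain ⟨h0, -, h2⟩ := mem_C.1 hb
  rw [← h2, Fintype.sum_eq_add_sum_subtype_ne b 0, add_sub_cancel_left, Nat.cast_sum]
  exact Finset.sum_congr rfl fun i _ => Int.toNat_of_nonneg (h0 i.1)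

theorem tail_injOn (h : Fin d → ℤ) (k : ℤ) : Set.InjOn tail (C h k : Set (Fin d → ℤ)) := by
  intro a ha b hb hab
  rw [mem_coe] at ha hb
  ext i
  rcases eq_or_ne i 0 with rfl | hi
  · have h1 := sum_tail ha
    rw [hab, sum_tail hb] at h1
    omega
  · have h1 : (a i).toNat = (b i).toNat := congrFun hab ⟨i, hi⟩
    have h2 : 0 ≤ a i := (mem_C.1 ha).1 i
    have h3 : 0 ≤ b i := (mem_C.1 hb).1 i
    omega

/-- If `k ≤ h₁` then the first coordinate of an element of `C(d, h, k)` can be as large as the sum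
allows, so that lowering the other coordinates stays possible. -/
theorem isLowerSet_image_tail {h : Fin d → ℤ} {k : ℤ} (hk : k ≤ h 0) :
    IsLowerSet (((C h k).image tail : Finset _) : Set ({i : Fin d // i ≠ 0} → ℕ)) := by
  intro t t' htt ht
  rw [mem_coe, Finset.mem_image] at ht ⊢
  obtain ⟨b, hb, rfl⟩ := ht
  obtain ⟨h0, h1, -⟩ := mem_C.1 hb
  have hsum : ((∑ i, t' i : ℕ) : ℤ) ≤ k - b 0 := by
    rw [← sum_tail hb]
    exact_mod_cast Finset.sum_le_sum fun i _ => htt i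
  have hb0 : 0 ≤ b 0 := h0 0
  have hne : ∀ i : {i : Fin d // i ≠ 0}, (if hi : i.1 = 0 then k - ((∑ i, t' i : ℕ) : ℤ)
      else (t' ⟨i.1, hi⟩ : ℤ)) = t' i := fun i => dif_neg i.2
  refine ⟨fun i => if hi : i = 0 then k - ((∑ i, t' i : ℕ) : ℤ) else (t' ⟨i, hi⟩ : ℤ),
    mem_C.2 ⟨fun i => ?_, fun i => ?_, ?_⟩, ?_⟩
  · by_cases hi : i = 0
    · simp only [hi, dif_pos, Pi.zero_apply]
      omega
    · simp [hi]
  · by_cases hi : i = 0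
    · simp only [hi, dif_pos]
      omega
    · have h2 : t' ⟨i, hi⟩ ≤ (b i).toNat := htt ⟨i, hi⟩
      have h3 : b i ≤ h i := h1 i
      have h4 : 0 ≤ b i := h0 i
      simp only [hi, dif_neg, not_false_eq_true]
      omega
  · rw [Fintype.sum_eq_add_sum_subtype_ne _ 0, Finset.sum_congr rfl fun i _ => hne i]
    simp
  · funext i
    simp only [tail, hne i, Int.toNat_natCast]

/-- On `C(d, h, k)` the tuple `b` is determined by its tail, so this is `det_prod_choose_sub` for the
lower set of tails. -/
theorem det_prod_choose_tail {h : Fin d → ℤ} {k : ℤ} (hk : k ≤ h 0) :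
    (Matrix.of fun c b : C h k =>
      ∏ i, ((tail h i - tail c.1 i).choose (tail b.1 i) : ℤ)).det =
        ∏ c ∈ C h k, (-1) ^ (k - c 0).toNat := by
  have hmem : ∀ c : C h k, tail c.1 ∈ (C h k).image tail := fun c => mem_image_of_mem _ c.2
  let e : C h k ≃ (C h k).image tail := Equiv.ofBijective (fun c => ⟨tail c.1, hmem c⟩) <| by
    constructor
    · intro a b hab
      exact Subtype.ext (tail_injOn h k a.2 b.2 (congrArg Subtype.val hab))
    · rintro ⟨t, ht⟩
      obtain ⟨b, hb, rfl⟩ := mem_image.1 ht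
      exact ⟨⟨b, hb⟩, rfl⟩
  have hle : ∀ t ∈ (C h k).image tail, t ≤ tail h := by
    intro t ht
    obtain ⟨b, hb, rfl⟩ := mem_image.1 ht
    exact fun i => Int.toNat_le_toNat ((mem_C.1 hb).2.1 i.1)
  have h1 := det_prod_choose_sub _ (isLowerSet_image_tail hk) (tail h) hle
  rw [← Matrix.det_submatrix_equiv_self e, ← Equiv.prod_comp e] at h1
  refine h1.trans ?_
  rw [← Finset.prod_coe_sort (C h k) fun c => (-1 : ℤ) ^ (k - c 0).toNat]
  refine Finset.prod_congr rfl fun c _ => ?_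
  have h2 := sum_tail c.2
  congr 1
  change ∑ i, tail c.1 i = _
  omega

/-- In the quotient of `ℤ[x₁, …, x_d]` by all `x_i ^ (h_i + 1)`, the change of basis in degree `k`
from monomials to the products `L ^ b₁ x₂ ^ b₂ ⋯ x_d ^ b_d`, where `L = x₁ + ⋯ + x_d`. -/
noncomputable def basisChange (h : Fin d → ℤ) (k : ℤ) : Matrix (C h k) (C h k) ℤ :=
  Matrix.of fun c b => multinom (b.1 0) (c.1 - (b.1 - Pi.single 0 (b.1 0)))

/-- A nonzero entry in row `c` and column `b` has `b_i ≤ c_i` for all `i ≠ 0`; as `c` and `b` have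
the same sum, `c₁ < b₁` off the diagonal. -/
theorem det_basisChange (h : Fin d → ℤ) (k : ℤ) : (basisChange h k).det = 1 := by
  rw [det_eq_prod_diag_of_rank fun c : C h k => c.1 0]
  · refine Finset.prod_eq_one fun b _ => ?_
    have h0 : 0 ≤ b.1 0 := (mem_C.1 b.2).1 0
    have h1 : (fun i => ((Pi.single 0 (b.1 0) : Fin d → ℤ) i).toNat) =
        Pi.single 0 (b.1 0).toNat := by
      funext i
      rcases eq_or_ne i 0 with rfl | hi
      · simp
      · simp [Pi.single_eq_of_ne hi]
    simp only [basisChange, Matrix.of_apply, sub_sub_cancel]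
    rw [multinom, if_pos ⟨fun i => (Pi.single_nonneg.2 h0 :
      (0 : Fin d → ℤ) ≤ Pi.single 0 (b.1 0)) i, by simp⟩, h1]
    simp [Nat.multinomial_single]
  · intro c b hne hcb
    have h0 := nonneg_of_multinom_ne_zero hne
    have hle : ∀ i, i ≠ 0 → b.1 i ≤ c.1 i := by
      intro i hi
      simpa [Pi.single_eq_of_ne hi] using h0 i
    have hc := (mem_C.1 c.2).2.2
    have hb := (mem_C.1 b.2).2.2
    by_contra! hlt
    have hall : ∀ i ∈ univ, b.1 i ≤ c.1 i := by
      intro i _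
      rcases eq_or_ne i 0 with rfl | hi
      · exact hlt
      · exact hle i hi
    have := (Finset.sum_eq_sum_iff_of_le hall).1 (hb.trans hc.symm)
    exact hcb (Subtype.ext (funext fun i => (this i (mem_univ i)).symm))

/-- Multiplication by `L ^ (n - k)` sends `L ^ b₁ x₂ ^ b₂ ⋯ x_d ^ b_d` to
`L ^ (n - k + b₁) x₂ ^ b₂ ⋯ x_d ^ b_d`. -/
theorem multinomMatrix_mul_basisChange {h : Fin d → ℤ} {n k : ℕ} (hnk : k ≤ n)
    (hh : ∑ i, h i = (k : ℤ) + n) :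
    (multinomMatrix h n k).submatrix (complEquiv h k n hh) id * basisChange h k =
      Matrix.of fun c b : C h k =>
        multinom ((n : ℤ) - k + b.1 0) (h - c.1 - (b.1 - Pi.single 0 (b.1 0))) := by
  ext c b
  have hb0 : 0 ≤ b.1 0 := (mem_C.1 b.2).1 0
  have hc := mem_C.1 c.2
  have hb := mem_C.1 b.2
  obtain ⟨q, hq⟩ := Int.eq_ofNat_of_zero_le hb0
  set t : Fin d → ℤ := b.1 - Pi.single 0 (b.1 0) with ht
  have ht0 : 0 ≤ t := by
    intro i
    rcases eq_or_ne i 0 with rfl | hi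
    · simp [ht]
    · simpa [ht, Pi.single_eq_of_ne hi] using hb.1 i
  have htsum : ∑ i, t i = k - q := by
    simp only [ht, Pi.sub_apply, Finset.sum_sub_distrib, hb.2.2]
    simp [hq]
  have h1 := sum_multinom_mul_multinom q (n - k) (h - c.1 - t)
  rw [Matrix.mul_apply, Matrix.of_apply, ← ht,
    show (n : ℤ) - k + b.1 0 = ((q + (n - k) : ℕ) : ℤ) by omega, ← h1]
  change ∑ x : C h k, multinom ((n : ℤ) - k) (h - c.1 - x.1) * multinom (b.1 0) (x.1 - t) = _
  rw [Finset.sum_coe_sort (C h k) fun x =>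
    multinom ((n : ℤ) - k) (h - c.1 - x) * multinom (b.1 0) (x - t), hq]
  -- Tuples outside `t + C(d, h - c - t, q)` contribute zero on the left.
  refine Finset.sum_bij_ne_zero (fun x _ _ => x - t) ?_ ?_ ?_ ?_
  · intro x hx hne
    have h2 := nonneg_of_multinom_ne_zero (left_ne_zero_of_mul hne)
    have h3 := nonneg_of_multinom_ne_zero (right_ne_zero_of_mul hne)
    have h4 := sum_eq_of_multinom_ne_zero (right_ne_zero_of_mul hne)
    exact mem_C.2 ⟨h3, sub_le_sub_right (sub_nonneg.1 h2) t, h4⟩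
  · intro x _ _ y _ _ hxy
    exact sub_left_injective hxy
  · intro y hy hne
    obtain ⟨h2, h3, h4⟩ := mem_C.1 hy
    refine ⟨y + t, mem_C.2 ⟨add_nonneg h2 ht0, ?_, ?_⟩, ?_, add_sub_cancel_right y t⟩
    · exact (le_sub_iff_add_le.1 h3).trans (sub_le_self _ hc.1)
    · simp only [Pi.add_apply, Finset.sum_add_distrib, h4, htsum]
      ring
    · rw [add_sub_cancel_right, show h - c.1 - (y + t) = h - c.1 - t - y by abel, mul_comm,
        ← Nat.cast_sub hnk]
      exact hne
  · intro x _ _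
    rw [show h - c.1 - t - (x - t) = h - c.1 - x by abel, mul_comm, ← Nat.cast_sub hnk]

/-- After multiplication by the factorials of `h - c` and division by those of `(n - k + b₁, b₂, …,
b_d)`, the multinomial coefficient splits into binomial coefficients. Both sides vanish when
`b_i > h_i - c_i` for some `i ≠ 0`. -/
theorem multinom_eq_mul_prod_choose {h : Fin d → ℤ} {n k : ℕ}
    (hh : ∑ i, h i = (k : ℤ) + n) {c b : Fin d → ℤ} (hc : c ∈ C h k) (hb : b ∈ C h k) :
    (multinom ((n : ℤ) - k + b 0) (h - c - (b - Pi.single 0 (b 0))) : ℚ) =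
      (∏ i, (((h - c) i).toNat.factorial : ℚ))⁻¹ *
        (∏ i, (((b + Pi.single 0 ((n : ℤ) - k) : Fin d → ℤ) i).toNat.factorial : ℚ)) *
        ∏ i, ((tail h i - tail c i).choose (tail b i) : ℚ) := by
  obtain ⟨hc0, hc1, hc2⟩ := mem_C.1 hc
  obtain ⟨hb0, hb1, hb2⟩ := mem_C.1 hb
  have hz : 0 ≤ b 0 := hb0 0
  have hne : ∀ i : {i : Fin d // i ≠ 0}, (Pi.single 0 ((n : ℤ) - k) : Fin d → ℤ) i = 0 ∧
      (Pi.single 0 (b 0) : Fin d → ℤ) i = 0 := fun i =>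
    ⟨Pi.single_eq_of_ne i.2 _, Pi.single_eq_of_ne i.2 _⟩
  have hsum : ∑ i, (h - c - (b - Pi.single 0 (b 0)) : Fin d → ℤ) i = (n : ℤ) - k + b 0 := by
    simp only [Pi.sub_apply, Finset.sum_sub_distrib, hh, hc2, hb2, Finset.sum_pi_single',
      mem_univ, if_true]
    ring
  have hw : ∀ i : {i : Fin d // i ≠ 0}, (b + Pi.single 0 ((n : ℤ) - k) : Fin d → ℤ) i = b i :=
    fun i => by rw [Pi.add_apply, (hne i).1, add_zero]
  have e2 : (b + Pi.single 0 ((n : ℤ) - k) : Fin d → ℤ) 0 = (n : ℤ) - k + b 0 := by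
    simp [add_comm]
  generalize (b + Pi.single 0 ((n : ℤ) - k) : Fin d → ℤ) = w at hw e2 ⊢
  by_cases hle : ∀ i : {i : Fin d // i ≠ 0}, tail b i ≤ tail h i - tail c i
  · have hnn : 0 ≤ h - c - (b - Pi.single 0 (b 0)) := by
      intro i
      have h1 : c i ≤ h i := hc1 i
      rcases eq_or_ne i 0 with rfl | hi
      · simpa using h1
      · have h2 : (b i).toNat ≤ (h i).toNat - (c i).toNat := hle ⟨i, hi⟩
        have h3 : 0 ≤ c i := hc0 i
        simp only [Pi.sub_apply, Pi.single_eq_of_ne hi, Pi.zero_apply]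
        omega
    rw [multinom_eq_div hnn hsum, Fintype.prod_eq_mul_prod_subtype_ne _ 0,
      Fintype.prod_eq_mul_prod_subtype_ne (fun i => (((h - c) i).toNat.factorial : ℚ)) 0,
      Fintype.prod_eq_mul_prod_subtype_ne (fun i => ((w i).toNat.factorial : ℚ)) 0]
    have e1 : (h - c - (b - Pi.single 0 (b 0)) : Fin d → ℤ) 0 = (h - c) 0 := by simp
    have e3 : ∏ i : {i : Fin d // i ≠ 0}, ((tail h i - tail c i).choose (tail b i) : ℚ) =
        (∏ i : {i : Fin d // i ≠ 0}, (((h - c) i).toNat.factorial : ℚ)) /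
          ((∏ i : {i : Fin d // i ≠ 0}, ((w i).toNat.factorial : ℚ)) *
          ∏ i : {i : Fin d // i ≠ 0},
            (((h - c - (b - Pi.single 0 (b 0)) : Fin d → ℤ) i).toNat.factorial : ℚ)) := by
      rw [← Finset.prod_mul_distrib, ← Finset.prod_div_distrib]
      refine Finset.prod_congr rfl fun i _ => ?_
      have h1 : c i ≤ h i := hc1 i
      have h2 : 0 ≤ c i := hc0 i
      have h3 : 0 ≤ b i := hb0 i
      have h4 : (b i).toNat ≤ (h i).toNat - (c i).toNat := hle i
      rw [Nat.cast_choose ℚ (hle i)]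
      simp only [Pi.sub_apply, (hne i).2, hw i, sub_zero, tail]
      congr 2
      · congr 1; omega
      · congr 2; omega
    have hf : ∀ m : ℕ, (m.factorial : ℚ) ≠ 0 := fun m => by
      exact_mod_cast Nat.factorial_ne_zero m
    rw [e1, e2, e3]
    have g1 := hf ((h - c) 0).toNat
    have g2 : ∏ i : {i : Fin d // i ≠ 0}, (((h - c) i).toNat.factorial : ℚ) ≠ 0 :=
      Finset.prod_ne_zero_iff.2 fun i _ => hf _
    have g3 : ∏ i : {i : Fin d // i ≠ 0}, ((w i).toNat.factorial : ℚ) ≠ 0 :=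
      Finset.prod_ne_zero_iff.2 fun i _ => hf _
    have g4 : ∏ i : {i : Fin d // i ≠ 0},
        (((h - c - (b - Pi.single 0 (b 0)) : Fin d → ℤ) i).toNat.factorial : ℚ) ≠ 0 :=
      Finset.prod_ne_zero_iff.2 fun i _ => hf _
    field_simp
  · push Not at hle
    obtain ⟨i, hi⟩ := hle
    have h1 : multinom ((n : ℤ) - k + b 0) (h - c - (b - Pi.single 0 (b 0))) = 0 := by
      by_contra hm
      have h2 := nonneg_of_multinom_ne_zero hm i
      simp only [Pi.sub_apply, (hne i).2, Pi.zero_apply] at h2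
      have h3 : 0 ≤ c i := hc0 i
      have h4 : (h i).toNat - (c i).toNat < (b i).toNat := hi
      omega
    rw [h1, Finset.prod_eq_zero (mem_univ i) (by rw [Nat.choose_eq_zero_of_lt hi, Nat.cast_zero])]
    simp

theorem det_multinomMatrix {h : Fin d → ℤ} {n k : ℕ} (hnk : k ≤ n)
    (hh : ∑ i, h i = (k : ℤ) + n) (hk : (k : ℤ) ≤ h 0) :
    ((((multinomMatrix h n k).submatrix (complEquiv h k n hh) id).det : ℤ) : ℚ) =
      (∏ c ∈ C h k, (-1) ^ ((k : ℤ) - c 0).toNat) *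
        ((∏ b ∈ C h n, (multinom n b : ℚ)) /
          ∏ b ∈ C h k, (multinom n (b + Pi.single 0 ((n : ℤ) - k)) : ℚ)) := by
  have hf : ∀ m : ℕ, (m.factorial : ℚ) ≠ 0 := fun m => by
    exact_mod_cast Nat.factorial_ne_zero m
  have hrow : ∏ b ∈ C h n, (multinom n b : ℚ) =
      ∏ c : C h k, ((n.factorial : ℚ) * (∏ i, (((h - c.1) i).toNat.factorial : ℚ))⁻¹) := by
    rw [← Finset.prod_coe_sort, ← Equiv.prod_comp (complEquiv h k n hh)]
    refine Finset.prod_congr rfl fun c _ => ?_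
    have h1 := mem_C.1 (complEquiv h k n hh c).2
    rw [multinom_eq_div h1.1 h1.2.2, div_eq_mul_inv, Int.toNat_natCast]
    rfl
  have hcol : ∏ b ∈ C h k, (multinom n (b + Pi.single 0 ((n : ℤ) - k)) : ℚ) =
      ∏ b : C h k, ((n.factorial : ℚ) /
        ∏ i, (((b.1 + Pi.single 0 ((n : ℤ) - k) : Fin d → ℤ) i).toNat.factorial : ℚ)) := by
    rw [← Finset.prod_coe_sort]
    refine Finset.prod_congr rfl fun b _ => ?_
    have h1 := mem_C.1 b.2
    rw [multinom_eq_div, Int.toNat_natCast]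
    · exact add_nonneg h1.1 (Pi.single_nonneg.2 (by omega))
    · simp [Finset.sum_add_distrib, h1.2.2]
  have hdet : ((multinomMatrix h n k).submatrix (complEquiv h k n hh) id).det =
      (Matrix.of fun c b : C h k =>
        multinom ((n : ℤ) - k + b.1 0) (h - c.1 - (b.1 - Pi.single 0 (b.1 0)))).det := by
    rw [← multinomMatrix_mul_basisChange hnk hh, Matrix.det_mul, det_basisChange, mul_one]
  have hsgn := congrArg (Int.cast : ℤ → ℚ) (det_prod_choose_tail hk)
  rw [Int.cast_det] at hsgn
  push_cast at hsgn
  rw [hdet, Int.cast_det, hrow, hcol, Finset.prod_mul_distrib, Finset.prod_div_distrib]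
  have hfac : (Matrix.of fun c b : C h k =>
        multinom ((n : ℤ) - k + b.1 0) (h - c.1 - (b.1 - Pi.single 0 (b.1 0)))).map
          (Int.cast : ℤ → ℚ) =
      Matrix.of fun c b : C h k => (∏ i, (((h - c.1) i).toNat.factorial : ℚ))⁻¹ *
        (Matrix.of fun c b : C h k =>
          (∏ i, (((b.1 + Pi.single 0 ((n : ℤ) - k) : Fin d → ℤ) i).toNat.factorial : ℚ)) *
          ((Matrix.of fun c b : C h k =>
            ∏ i, ((tail h i - tail c.1 i).choose (tail b.1 i) : ℤ)).map
              (Int.cast : ℤ → ℚ)) c b) c b := by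
    ext c b
    simp only [Matrix.map_apply, Matrix.of_apply]
    rw [multinom_eq_mul_prod_choose hh c.2 b.2]
    push_cast
    ring
  rw [hfac, Matrix.det_mul_column, Matrix.det_mul_row, hsgn]
  have g1 : ∏ c : C h k, (n.factorial : ℚ) ≠ 0 := Finset.prod_ne_zero_iff.2 fun _ _ => hf _
  have g2 : ∏ b : C h k,
      ∏ i, (((b.1 + Pi.single 0 ((n : ℤ) - k) : Fin d → ℤ) i).toNat.factorial : ℚ) ≠ 0 :=
    Finset.prod_ne_zero_iff.2 fun _ _ => Finset.prod_ne_zero_iff.2 fun _ _ => hf _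
  field_simp

end Tail

/-! ### Dominance -/

theorem sum_mul_cartanMatrix_A {d : ℕ} (s : Fin d → ℤ) (j : Fin d) :
    ∑ i, s i * CartanMatrix.A d i j =
      2 * s j - (if hj : 0 < (j : ℕ) then s ⟨j - 1, by omega⟩ else 0) -
        (if hj : (j : ℕ) + 1 < d then s ⟨j + 1, hj⟩ else 0) := by
  have h1 : ∀ i, s i * CartanMatrix.A d i j = (if i = j then 2 * s i else 0) -
      (if (i : ℕ) + 1 = j then s i else 0) - (if (j : ℕ) + 1 = i then s i else 0) := by
    intro i
    simp only [CartanMatrix.A, Matrix.of_apply, Fin.ext_iff]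
    split_ifs <;> omega
  rw [Finset.sum_congr rfl fun i _ => h1 i, Finset.sum_sub_distrib, Finset.sum_sub_distrib,
    Finset.sum_ite_eq' univ j, if_pos (mem_univ j)]
  congr 1
  · congr 1
    split_ifs with hj
    · rw [Finset.sum_eq_single ⟨j - 1, by omega⟩ _ (by simp)]
      · exact if_pos (Nat.sub_add_cancel hj)
      · exact fun i _ hi => if_neg fun h => hi (Fin.ext (by simp only; omega))
    · exact Finset.sum_eq_zero fun i _ => if_neg (by omega)
  · split_ifs with hj
    · rw [Finset.sum_eq_single ⟨j + 1, hj⟩ _ (by simp)]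
      · exact if_pos rfl
      · exact fun i _ hi => if_neg fun h => hi (Fin.ext (by simp only; omega))
    · exact Finset.sum_eq_zero fun i _ => if_neg (by omega)

theorem nu_apply {d : ℕ} [NeZero d] (n : ℕ) (s : Fin d → ℕ) (j : Fin d) :
    nu n s j = (2 * (n : ℤ) - 1) * (if j = 0 then 1 else 0) - s j - gaps s j +
      (if hj : 0 < (j : ℕ) then (s ⟨j - 1, by omega⟩ : ℤ) else 0) := by
  have h := sum_mul_cartanMatrix_A (fun i => (s i : ℤ)) j
  simp only [nu, fundWeight, simpleRoot, gaps, Pi.sub_apply, Pi.smul_apply, Finset.sum_apply,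
    smul_eq_mul, Pi.single_apply]
  rw [h]
  ring

theorem nu_zero {d : ℕ} [NeZero d] (n : ℕ) (s : Fin d → ℕ) :
    nu n s 0 = 2 * (n : ℤ) - 1 - s 0 - gaps s 0 := by
  simp [nu_apply]

theorem nu_succ {d : ℕ} [NeZero d] (n : ℕ) (s : Fin d → ℕ) (i : ℕ) (hi : i + 1 < d) :
    nu n s ⟨i + 1, hi⟩ = gaps s ⟨i, by omega⟩ - gaps s ⟨i + 1, hi⟩ := by
  rw [nu_apply, if_neg fun h => by simpa using congrArg Fin.val h]
  simp only [gaps, hi, dif_pos, Nat.succ_pos, Nat.add_sub_cancel]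
  ring

/-- With `d ≤ 3` summands, `h₁ ≤ n - k - 1` leaves at least `2 k + 1` to the at most two remaining
`h_i`, so one of these is more than `k`, and `h₁` is at least as large. -/
theorem le_gaps_zero {d : ℕ} [NeZero d] (hd : d = 2 ∨ d = 3) {n k : ℕ} {s : Fin d → ℕ}
    (hs : s 0 = n + k) (hdom : IsDominant (nu n s)) : (k : ℤ) ≤ gaps s 0 := by
  have h0 := hdom 0
  rw [nu_zero, hs] at h0
  have hsum := sum_gaps s hs
  rcases hd with rfl | rfl
  · have h1 := hdom ⟨1, by omega⟩
    rw [nu_succ n s 0 (by omega)] at h1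
    rw [Fin.sum_univ_two] at hsum
    change 0 ≤ gaps s 0 - gaps s 1 at h1
    push_cast at h0
    omega
  · have h1 := hdom ⟨1, by omega⟩
    have h2 := hdom ⟨2, by omega⟩
    rw [nu_succ n s 0 (by omega)] at h1
    rw [nu_succ n s 1 (by omega)] at h2
    rw [Fin.sum_univ_three] at hsum
    change 0 ≤ gaps s 0 - gaps s 1 at h1
    change 0 ≤ gaps s 1 - gaps s 2 at h2
    push_cast at h0
    omega

end MultinomialDet

theorem mainTheorem9 (d : ℕ) [NeZero d] (hd : 2 ≤ d) (n k : ℕ) (s : Fin d → ℕ)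
    (hs : s 0 = n + k) (hdom : MultinomialDet.IsDominant (MultinomialDet.nu n s)) :
    ((k : ℤ) ≤ MultinomialDet.gaps s 0 →
      (∀ l : ℕ, l ≤ k →
        MultinomialDet.delta (MultinomialDet.gaps s) ((k : ℤ) - l) =
          (((MultinomialDet.C (MultinomialDet.gaps s) k).filter
            fun b => b 0 = (l : ℤ)).card : ℤ)) ∧
      (∀ k' : ℤ, IsGreatest {j : ℤ | Odd j ∧ j ≤ k} k' →
        ((((MultinomialDet.multinomMatrix (MultinomialDet.gaps s) n k).submatrix
            (MultinomialDet.complEquiv (MultinomialDet.gaps s) k n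
              (MultinomialDet.sum_gaps s hs)) id).det : ℤ) : ℚ) =
          (-1) ^ MultinomialDet.S (MultinomialDet.gaps s) k' *
            ((∏ b ∈ MultinomialDet.C (MultinomialDet.gaps s) n, (MultinomialDet.multinom n b : ℚ)) /
              ∏ b' ∈ MultinomialDet.C (MultinomialDet.gaps s) k,
                (MultinomialDet.multinom n (b' + Pi.single 0 ((n : ℤ) - k)) : ℚ)))) ∧
    (d = 2 ∨ d = 3 → (k : ℤ) ≤ MultinomialDet.gaps s 0) := by
  refine ⟨fun hk => ⟨fun l _ => MultinomialDet.delta_sub hk (Int.natCast_nonneg l),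
    fun k' hk' => ?_⟩, fun hd' => MultinomialDet.le_gaps_zero hd' hs hdom⟩
  have hnk : k ≤ n := by
    have h0 := hdom 0
    rw [MultinomialDet.nu_zero, hs] at h0
    push_cast at h0
    omega
  have hsign := congrArg (Int.cast : ℤ → ℚ) (MultinomialDet.neg_one_pow_S hk hk')
  push_cast at hsign
  rw [hsign]
  exact MultinomialDet.det_multinomMatrix hnk (MultinomialDet.sum_gaps s hs) hk
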